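/- Work in the hyperbolic plane $\mathbb{H}^2$. A convex body is a compact geodesically convex set $K\subset\mathbb{H}^2$ that is the closure of its non-empty interior. A supporting geodesic of $K$ is a geodesic line that meets $\partial K$ and bounds a closed half-plane containing $K$. A geodesic $N$ is normal to $\partial K$ at $x\in\partial K\cap N$ if it is perpendicular to some supporting geodesic $\Gamma$ of $K$ through $x$; it is a double normal geodesic of $K$ if it is normal to $\partial K$ at two distinct points. The width of $K$ at $x\in\partial K$ along a normal geodesic $N$ at $x$ is the distance from $x$ to the point $N\cap\Gamma_2$, where $\Gamma_2\neq\Gamma$ is the other supporting geodesic of $K$ perpendicular to $N$; $K$ has constant width $w$ if all these widths are equal to $w$ (for every $x\in\partial K$ and every normal geodesic at $x$). No smoothness of $\partial K$ is assumed. The projection of $K$ onto a geodesic $M$ is \[ P_M(K)=\{x\in M : \text{the geodesic through } x \text{ perpendicular to } M \text{ meets } K\}, \] and $|P_M(K)|$ denotes its length. Proposition. Let $K\subset\mathbb{H}^2$ be a convex body of constant width $w$, and let $M$ be a geodesic line. Then \[ |P_M(K)|\le w, \] and equality holds if and only if $M$ is a double normal geodesic of $K$. -/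

import Mathlib

open scoped UpperHalfPlane

namespace HypPlane

/-- A geodesic line of the upper half-plane model: a vertical half-line `re z = a`, or a
half-circle with centre `c` on the real axis and radius `r > 0`. Distinct terms are distinct
lines. -/
inductive Geodesic : Type
  | vertical (a : ℝ) : Geodesic
  | halfCircle (c r : ℝ) (hr : 0 < r) : Geodesic

namespace Geodesic

/-- The defining function of a geodesic: it vanishes exactly on the geodesic and is positive on
one, negative on the other of the two open half-planes that the geodesic bounds. -/
def side : Geodesic → ℍ → ℝ
  | vertical a, z => z.re - a
  | halfCircle c r _, z => (z.re - c) ^ 2 + z.im ^ 2 - r ^ 2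

/-- The points of the geodesic. -/
def carrier (Γ : Geodesic) : Set ℍ := {z | Γ.side z = 0}

instance : Membership ℍ Geodesic := ⟨fun Γ z => z ∈ Γ.carrier⟩

/-- A (Euclidean) tangent vector of the geodesic at its point `z`: the vertical vector `i`, or the
radius vector `z - c` turned by a right angle. -/
noncomputable def tangent : Geodesic → ℍ → ℂ
  | vertical _, _ => Complex.I
  | halfCircle c _ _, z => Complex.I * ((z : ℂ) - (c : ℂ))

/-- Two geodesics are perpendicular if they meet at a right angle. The model is conformal, so that
the angle is the Euclidean one. -/
def Perp (Γ Δ : Geodesic) : Prop :=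
  ∃ z : ℍ, z ∈ Γ ∧ z ∈ Δ ∧ inner ℝ (Γ.tangent z) (Δ.tangent z) = 0

end Geodesic

/-- The geodesic segment `[x, y]`. -/
def segment (x y : ℍ) : Set ℍ := {z | dist x z + dist z y = dist x y}

/-- A convex body: a compact set that is the closure of its non-empty interior and contains the
geodesic segment between any two of its points. -/
structure IsConvexBody (K : Set ℍ) : Prop where
  isCompact : IsCompact K
  interior_nonempty : (interior K).Nonempty
  closure_interior : closure (interior K) = K
  segment_subset : ∀ x ∈ K, ∀ y ∈ K, segment x y ⊆ K

/-- `Γ` is a supporting geodesic of `K`: it meets the boundary of `K`, and `K` lies in one of the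
two closed half-planes bounded by `Γ`. -/
def Supports (Γ : Geodesic) (K : Set ℍ) : Prop :=
  (∃ x ∈ frontier K, x ∈ Γ) ∧ ((∀ z ∈ K, 0 ≤ Γ.side z) ∨ (∀ z ∈ K, Γ.side z ≤ 0))

/-- `N` meets the boundary of `K` perpendicularly at `x`: there `N` is perpendicular to a
supporting geodesic of `K` through `x` (the only one, if the boundary is smooth at `x`). -/
def IsNormalAt (N : Geodesic) (K : Set ℍ) (x : ℍ) : Prop :=
  x ∈ frontier K ∧ x ∈ N ∧ ∃ Γ : Geodesic, Supports Γ K ∧ x ∈ Γ ∧ N.Perp Γ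

/-- A double normal geodesic of `K`: it meets the boundary perpendicularly at two points. -/
def IsDoubleNormal (N : Geodesic) (K : Set ℍ) : Prop :=
  ∃ x y : ℍ, x ≠ y ∧ IsNormalAt N K x ∧ IsNormalAt N K y

/-- `K` has width `d` at the boundary point `x` along its normal geodesic `N` at `x`: besides the
supporting geodesic `Γ` through `x` perpendicular to `N`, there is another supporting geodesic
`Γ₂` perpendicular to `N`, and its intersection point with `N` is at distance `d` from `x`. -/
def HasWidthAt (K : Set ℍ) (x : ℍ) (N : Geodesic) (d : ℝ) : Prop :=
  ∃ (Γ Γ₂ : Geodesic) (y : ℍ), Supports Γ K ∧ x ∈ Γ ∧ N.Perp Γ ∧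
    Γ₂ ≠ Γ ∧ Supports Γ₂ K ∧ N.Perp Γ₂ ∧ y ∈ N ∧ y ∈ Γ₂ ∧ dist x y = d

/-- `K` has constant width `w`: the width is `w` at every boundary point, along every normal
geodesic of `K` there. -/
def HasConstantWidth (K : Set ℍ) (w : ℝ) : Prop :=
  ∀ (x : ℍ) (N : Geodesic), IsNormalAt N K x → HasWidthAt K x N w

/-- The projection of `K` onto `M`: the points `x` of `M` such that the geodesic through `x`
perpendicular to `M` meets `K`. -/
def projection (M : Geodesic) (K : Set ℍ) : Set ℍ :=
  {x | x ∈ M ∧ ∃ N : Geodesic, N.Perp M ∧ x ∈ N ∧ ∃ z ∈ K, z ∈ N}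

/-- Length of a subset of a geodesic: its one-dimensional Hausdorff measure for the hyperbolic
distance. -/
noncomputable def length (S : Set ℍ) : ENNReal := MeasureTheory.Measure.hausdorffMeasure 1 S

end HypPlane

/-!
Every geodesic `M` carries Fermi coordinates: the arc length coordinate `M.coord z` of the orthogonal
projection of `z` onto `M`, and the hyperbolic sine `M.height z` of the signed distance of `z` from
`M`. In these coordinates the hyperbolic distance is given by `Geodesic.cosh_dist_eq`. Consequently
the projection onto `M` does not increase distances (`Geodesic.abs_coord_sub_le_dist`), and it
preserves the distance of two distinct points only if both lie on `M`
(`Geodesic.mem_of_abs_coord_sub_eq_dist`). The perpendiculars of `M` are exactly the fibres of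
`M.coord`, so that the supporting geodesics of a convex body `K` perpendicular to `M` are the fibres
over the end points of the interval `M.coord '' K`. Along a normal geodesic the width is therefore
the length of the projection (`HasConstantWidth.sub_eq_of_isNormalAt`).

If `p`, `q` are points of `K` at maximal distance, the geodesic `N` through them is normal to the
boundary at both, because a point of `K` that projects onto `N` beyond `p` would be too far from `q`.
Hence the diameter of a body of constant width `w` is `w` (the inequality needed is
`HasConstantWidth.dist_le`). For arbitrary `M`, the end points of the projection of `K` are the
projections of two points `p`, `q` of `K`, so its length is at most `dist p q ≤ w`. If it equals `w`,
then `p` and `q` lie on `M`, and the perpendiculars of `M` there support `K`, so `M` is a double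
normal. Conversely the projection onto a normal geodesic has length `w`.
-/

namespace HypPlane

namespace Geodesic

/-! ### Fermi coordinates along a geodesic -/

/-- The parametrisation of a geodesic by arc length. -/
noncomputable def param : Geodesic → ℝ → ℍ
  | vertical a, s => ⟨⟨a, Real.exp s⟩, Real.exp_pos s⟩
  | halfCircle c r hr, s =>
      ⟨⟨c + r * Real.tanh s, r / Real.cosh s⟩, div_pos hr (Real.cosh_pos s)⟩

/-- The arc length coordinate, along the geodesic, of the orthogonal projection of a point. -/
noncomputable def coord : Geodesic → ℍ → ℝ
  | vertical a, z => Real.log ((z.re - a) ^ 2 + z.im ^ 2) / 2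
  | halfCircle c r _, z =>
      Real.log (((z.re - c + r) ^ 2 + z.im ^ 2) / ((z.re - c - r) ^ 2 + z.im ^ 2)) / 2

/-- The hyperbolic sine of the signed distance of a point from the geodesic. -/
noncomputable def height : Geodesic → ℍ → ℝ
  | vertical a, z => (z.re - a) / z.im
  | halfCircle c r _, z => ((z.re - c) ^ 2 + z.im ^ 2 - r ^ 2) / (2 * r * z.im)

/-- The geodesic perpendicular to the given one at the point with arc length coordinate `s`. For a
half-circle it is the vertical line through the centre when `s = 0`, where `cosh s / sinh s` is
infinite. -/
noncomputable def perpAt : Geodesic → ℝ → Geodesic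
  | vertical a, s => halfCircle a (Real.exp s) (Real.exp_pos s)
  | halfCircle c r hr, s =>
      if h : s = 0 then vertical c
      else halfCircle (c + r * Real.cosh s / Real.sinh s) (r / |Real.sinh s|)
        (div_pos hr (abs_pos.2 (mt Real.sinh_eq_zero.1 h)))

theorem mem_iff {M : Geodesic} {z : ℍ} : z ∈ M ↔ M.side z = 0 := Iff.rfl

theorem mem_iff_height_eq_zero {M : Geodesic} {z : ℍ} : z ∈ M ↔ M.height z = 0 := by
  have hy := z.im_pos
  cases M with
  | vertical a => simp [mem_iff, side, height, hy.ne']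
  | halfCircle c r hr => simp [mem_iff, side, height, hy.ne', hr.ne']

theorem exp_two_mul_coord_vertical (a : ℝ) (z : ℍ) :
    Real.exp (2 * (vertical a).coord z) = (z.re - a) ^ 2 + z.im ^ 2 := by
  have hy := z.im_pos
  rw [coord, mul_div_cancel₀ _ two_ne_zero, Real.exp_log (by positivity)]

theorem exp_two_mul_coord_halfCircle (c r : ℝ) (hr : 0 < r) (z : ℍ) :
    Real.exp (2 * (halfCircle c r hr).coord z) =
      ((z.re - c + r) ^ 2 + z.im ^ 2) / ((z.re - c - r) ^ 2 + z.im ^ 2) := by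
  have hy := z.im_pos
  rw [coord, mul_div_cancel₀ _ two_ne_zero, Real.exp_log (by positivity)]

theorem param_mem (M : Geodesic) (s : ℝ) : M.param s ∈ M := by
  cases M with
  | vertical a => simp [mem_iff, side, param, UpperHalfPlane.re]
  | halfCircle c r hr =>
    have h := Real.cosh_sq s
    have h0 := (Real.cosh_pos s).ne'
    simp only [mem_iff, side, param, UpperHalfPlane.re, UpperHalfPlane.im,
      Real.tanh_eq_sinh_div_cosh]
    field_simp
    linear_combination -r ^ 2 * h

theorem coord_param (M : Geodesic) (s : ℝ) : M.coord (M.param s) = s := by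
  have key : Real.exp (2 * M.coord (M.param s)) = Real.exp (2 * s) := by
    cases M with
    | vertical a =>
      rw [exp_two_mul_coord_vertical]
      simp [param, UpperHalfPlane.re, UpperHalfPlane.im, two_mul, Real.exp_add, sq]
    | halfCircle c r hr =>
      have h0 := Real.cosh_pos s
      have hy := ((halfCircle c r hr).param s).im_pos
      rw [exp_two_mul_coord_halfCircle, div_eq_iff (by positivity)]
      simp only [param, UpperHalfPlane.re, UpperHalfPlane.im, Real.tanh_eq_sinh_div_cosh]
      field_simp
      have h1 := Real.cosh_add_sinh s
      have h2 := Real.cosh_sub_sinh s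
      have h := Real.cosh_sq s
      have h3 : Real.exp (2 * s) * Real.exp (-s) = Real.exp s := by rw [← Real.exp_add]; ring_nf
      rw [← h1, ← h2] at h3
      linear_combination (-2 * r ^ 2 * Real.cosh s) * h3 + r ^ 2 * (Real.exp (2 * s) - 1) * h
  have := Real.exp_injective key
  linarith

/-- The hyperbolic distance in Fermi coordinates: with `height = sinh u` it says that
`cosh d = cosh (t - t') * cosh u * cosh u' - sinh u * sinh u'`. -/
theorem cosh_dist_eq (M : Geodesic) (z w : ℍ) :
    Real.cosh (dist z w) =
      Real.cosh (M.coord z - M.coord w) * (√(1 + M.height z ^ 2) * √(1 + M.height w ^ 2)) -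
        M.height z * M.height w := by
  have hz := z.im_pos
  have hw := w.im_pos
  have hEz := Real.exp_pos (M.coord z)
  have hEw := Real.exp_pos (M.coord w)
  have h2 : ∀ p : ℍ, Real.exp (2 * M.coord p) = Real.exp (M.coord p) ^ 2 := fun p => by
    rw [two_mul, Real.exp_add, sq]
  have hcosh : Real.cosh (M.coord z - M.coord w) =
      (Real.exp (M.coord z) / Real.exp (M.coord w) +
        Real.exp (M.coord w) / Real.exp (M.coord z)) / 2 := by
    rw [Real.cosh_eq, neg_sub, Real.exp_sub, Real.exp_sub]
  rw [hcosh, UpperHalfPlane.cosh_dist']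
  cases M with
  | vertical a =>
    have hE := fun p => (h2 p).symm.trans (exp_two_mul_coord_vertical a p)
    have hC : ∀ p : ℍ, √(1 + (vertical a).height p ^ 2) =
        Real.exp ((vertical a).coord p) / p.im := fun p => by
      have hp := p.im_pos
      rw [Real.sqrt_eq_iff_mul_self_eq (by positivity) (by positivity), height,
        ← sq, div_pow, div_pow, hE]
      field_simp
      ring
    rw [hC, hC, height, height]
    have h1 := hE z
    have h2 := hE w
    field_simp
    rw [h1, h2]
    ring
  | halfCircle c r hr =>
    have hB : ∀ p : ℍ, 0 < (p.re - c - r) ^ 2 + p.im ^ 2 := fun p => by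
      have hp := p.im_pos
      positivity
    have hE : ∀ p : ℍ, Real.exp ((halfCircle c r hr).coord p) ^ 2 *
        ((p.re - c - r) ^ 2 + p.im ^ 2) = (p.re - c + r) ^ 2 + p.im ^ 2 := fun p => by
      rw [← h2, exp_two_mul_coord_halfCircle, div_mul_cancel₀ _ (hB p).ne']
    -- The hyperbolic cosine of the distance of `p` from the geodesic, multiplied by
    -- `2 * r * p.im`, is the geometric mean of the numerator and the denominator of
    -- `exp (2 * coord p)`.
    have hC : ∀ p : ℍ, √(1 + (halfCircle c r hr).height p ^ 2) =
        Real.exp ((halfCircle c r hr).coord p) * ((p.re - c - r) ^ 2 + p.im ^ 2) /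
          (2 * r * p.im) := fun p => by
      have hp := p.im_pos
      have hB := hB p
      rw [Real.sqrt_eq_iff_mul_self_eq (by positivity) (by positivity), height]
      field_simp
      linear_combination -((p.re - c - r) ^ 2 + p.im ^ 2) * hE p
    rw [hC, hC, height, height]
    have h1 := hE z
    have h2 := hE w
    set E := Real.exp ((halfCircle c r hr).coord z)
    set F := Real.exp ((halfCircle c r hr).coord w)
    set B := (z.re - c - r) ^ 2 + z.im ^ 2 with hBz
    set D := (w.re - c - r) ^ 2 + w.im ^ 2 with hDw
    have h3 : (E / F + F / E) / 2 * (E * B / (2 * r * z.im) * (F * D / (2 * r * w.im))) =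
        (E ^ 2 * B * D + F ^ 2 * D * B) / (8 * r ^ 2 * z.im * w.im) := by
      field_simp
      ring
    rw [h3, h1, h2, hBz, hDw]
    field_simp
    ring

/-- Any two points lie on a common geodesic. -/
theorem exists_mem_mem (z w : ℍ) : ∃ M : Geodesic, z ∈ M ∧ w ∈ M := by
  by_cases h : z.re = w.re
  · exact ⟨vertical z.re, by simp [mem_iff, side], by simp [mem_iff, side, h]⟩
  · have h' : w.re - z.re ≠ 0 := sub_ne_zero.2 (Ne.symm h)
    have hy := z.im_pos
    set c := (w.re ^ 2 + w.im ^ 2 - z.re ^ 2 - z.im ^ 2) / (2 * (w.re - z.re)) with hc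
    have hc' : c * (2 * (w.re - z.re)) = w.re ^ 2 + w.im ^ 2 - z.re ^ 2 - z.im ^ 2 := by
      rw [hc]; field_simp
    have hp : 0 < (z.re - c) ^ 2 + z.im ^ 2 := by positivity
    refine ⟨halfCircle c √((z.re - c) ^ 2 + z.im ^ 2) (Real.sqrt_pos.2 hp), ?_, ?_⟩
    · simp only [mem_iff, side, Real.sq_sqrt hp.le]; ring
    · simp only [mem_iff, side, Real.sq_sqrt hp.le]; linear_combination -hc'

theorem perp_comm {M N : Geodesic} : M.Perp N ↔ N.Perp M :=
  ⟨fun ⟨z, h1, h2, h⟩ => ⟨z, h2, h1, by rwa [real_inner_comm]⟩,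
    fun ⟨z, h1, h2, h⟩ => ⟨z, h2, h1, by rwa [real_inner_comm]⟩⟩

/-- Up to a positive factor and a sign that does not depend on the point, the defining function of the
perpendicular at `s` is the difference of `exp (2 * coord)` and `exp (2 * s)`; hence the half-planes
that the perpendicular bounds are given by inequalities between the coordinate and `s`. -/
theorem exists_perpAt_side_eq (M : Geodesic) (s : ℝ) :
    (∀ z, ∃ k > 0, (M.perpAt s).side z =
      k * (Real.exp (2 * M.coord z) - Real.exp (2 * s))) ∨
    (∀ z, ∃ k > 0, (M.perpAt s).side z =
      k * (Real.exp (2 * s) - Real.exp (2 * M.coord z))) := by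
  cases M with
  | vertical a =>
    refine Or.inl fun z => ⟨1, one_pos, ?_⟩
    rw [exp_two_mul_coord_vertical, two_mul s, Real.exp_add, perpAt, side]
    ring
  | halfCircle c r hr =>
    have hB : ∀ p : ℍ, 0 < (p.re - c - r) ^ 2 + p.im ^ 2 := fun p => by
      have hp := p.im_pos
      positivity
    by_cases hs : s = 0
    · refine Or.inl fun z => ⟨((z.re - c - r) ^ 2 + z.im ^ 2) / (4 * r),
        div_pos (hB z) (by positivity), ?_⟩
      rw [exp_two_mul_coord_halfCircle, perpAt, dif_pos hs, side, hs]
      have := (hB z).ne'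
      simp only [mul_zero, Real.exp_zero]
      field_simp
      ring
    · have hS : Real.sinh s ≠ 0 := mt Real.sinh_eq_zero.1 hs
      have key : ∀ z : ℍ, ((halfCircle c r hr).perpAt s).side z =
          ((z.re - c - r) ^ 2 + z.im ^ 2) * Real.exp (-s) / (2 * Real.sinh s) *
            (Real.exp (2 * s) - Real.exp (2 * (halfCircle c r hr).coord z)) := fun z => by
        have h1 := Real.cosh_add_sinh s
        have h2 := Real.cosh_sub_sinh s
        have h3 : Real.exp (2 * s) = Real.exp s ^ 2 := by rw [two_mul, Real.exp_add, sq]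
        have h := Real.cosh_sq s
        have := (hB z).ne'
        rw [exp_two_mul_coord_halfCircle, perpAt, dif_neg hs, side, h3, ← h1, ← h2,
          div_pow r, sq_abs]
        field_simp
        linear_combination (2 * r ^ 2 - Real.sinh s * (Real.cosh s + Real.sinh s) *
          ((z.re - c - r) ^ 2 + z.im ^ 2)) * h
      rcases lt_or_gt_of_ne hs with h | h
      · refine Or.inl fun z => ⟨((z.re - c - r) ^ 2 + z.im ^ 2) * Real.exp (-s) /
          (2 * -Real.sinh s), ?_, ?_⟩
        · have := Real.sinh_neg_iff.2 h
          exact div_pos (mul_pos (hB z) (Real.exp_pos _)) (by linarith)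
        · rw [key]
          field_simp
          ring
      · exact Or.inr fun z => ⟨_, div_pos (mul_pos (hB z) (Real.exp_pos _))
          (mul_pos two_pos (Real.sinh_pos_iff.2 h)), key z⟩

/-- The two half-planes bounded by the perpendicular at `s` are those where the coordinate is at
least `s` and at most `s`; which of them is the positive one depends on `M` and `s`. -/
theorem perpAt_side (M : Geodesic) (s : ℝ) :
    (∀ z, (0 ≤ (M.perpAt s).side z ↔ s ≤ M.coord z) ∧
      ((M.perpAt s).side z ≤ 0 ↔ M.coord z ≤ s)) ∨
    (∀ z, (0 ≤ (M.perpAt s).side z ↔ M.coord z ≤ s) ∧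
      ((M.perpAt s).side z ≤ 0 ↔ s ≤ M.coord z)) := by
  have hexp : ∀ x y : ℝ, Real.exp (2 * x) ≤ Real.exp (2 * y) ↔ x ≤ y := fun x y => by
    rw [Real.exp_le_exp, mul_le_mul_iff_right₀ two_pos]
  refine (M.exists_perpAt_side_eq s).imp (fun h z => ?_) (fun h z => ?_) <;>
  · obtain ⟨k, hk, h⟩ := h z
    rw [h, mul_nonneg_iff_of_pos_left hk, sub_nonneg, hexp,
      ← not_lt (b := k * _), mul_pos_iff_of_pos_left hk, not_lt, sub_nonpos, hexp]
    exact ⟨Iff.rfl, Iff.rfl⟩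

theorem mem_perpAt {M : Geodesic} {s : ℝ} {z : ℍ} : z ∈ M.perpAt s ↔ M.coord z = s := by
  rw [mem_iff]
  rcases M.perpAt_side s with h | h
  · rw [le_antisymm_iff, (h z).1, (h z).2, ← le_antisymm_iff]
  · rw [le_antisymm_iff, (h z).1, (h z).2, ← le_antisymm_iff, eq_comm]

theorem perp_perpAt (M : Geodesic) (s : ℝ) : M.Perp (M.perpAt s) := by
  refine ⟨M.param s, M.param_mem s, mem_perpAt.2 (M.coord_param s), ?_⟩
  cases M with
  | vertical a => simp [tangent, perpAt, param, Complex.inner]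
  | halfCircle c r hr =>
    by_cases hs : s = 0
    · simp [tangent, perpAt, param, Complex.inner, hs]
    · have hS : Real.sinh s ≠ 0 := mt Real.sinh_eq_zero.1 hs
      have hC := (Real.cosh_pos s).ne'
      have h := Real.cosh_sq s
      simp only [tangent, perpAt, param, dif_neg hs, Real.tanh_eq_sinh_div_cosh]
      generalize Real.sinh s = S at *
      generalize Real.cosh s = C at *
      rw [Complex.inner, Complex.ofReal_add]
      simp only [Complex.mul_re, Complex.conj_re, Complex.conj_im, Complex.mul_im, Complex.sub_re,
        Complex.sub_im, Complex.I_re, Complex.I_im, Complex.add_re, Complex.add_im,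
        Complex.ofReal_re, Complex.ofReal_im]
      field_simp
      linear_combination -(S * r ^ 2) * h

theorem Perp.exists_eq_perpAt {M N : Geodesic} (h : M.Perp N) : ∃ s, N = M.perpAt s := by
  obtain ⟨z, hM, hN, h⟩ := h
  rw [mem_iff] at hM hN
  cases M with
  | vertical a =>
    cases N with
    | vertical b => simp [tangent] at h
    | halfCircle c r hr =>
      simp [tangent, side, Complex.inner] at h hM
      refine ⟨Real.log r, ?_⟩
      simp only [perpAt, Real.exp_log hr]
      congr 1
      linarith
  | halfCircle c r hr =>
    cases N with
    | vertical b =>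
      simp [tangent, side, Complex.inner] at h hN
      refine ⟨0, ?_⟩
      simp only [perpAt, dif_pos]
      congr 1
      linarith
    | halfCircle b q hq =>
      simp [tangent, side, Complex.inner] at h hM hN
      -- Two half-circles meet at a right angle when the square of the distance of the centres is
      -- the sum of the squares of the radii.
      have hbc : (b - c) ^ 2 = r ^ 2 + q ^ 2 := by linear_combination hM + hN - 2 * h
      -- With `σ` the sign of `b - c`, the parameter `s` is found from `q = r / |sinh s|` and
      -- `b - c = r * cosh s / sinh s`, which give `sinh s = σ * r / q` and `cosh s = |b - c| / q`.
      have hd : 0 < (b - c) ^ 2 := by rw [hbc]; positivity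
      obtain ⟨σ, hσ, hσd⟩ : ∃ σ : ℝ, σ ^ 2 = 1 ∧ b - c = σ * |b - c| := by
        rcases abs_choice (b - c) with h | h <;> rw [h]
        · exact ⟨1, by norm_num, by ring⟩
        · exact ⟨-1, by norm_num, by ring⟩
      have hd0 : 0 < |b - c| := abs_pos.2 (pow_ne_zero_iff two_ne_zero |>.1 hd.ne')
      have hσ0 : σ ≠ 0 := by rintro rfl; norm_num at hσ
      have hσ1 : |σ| = 1 := by
        rwa [← pow_eq_one_iff_of_nonneg (abs_nonneg _) two_ne_zero, sq_abs]
      have hcosh : Real.cosh (Real.arsinh (σ * r / q)) = |b - c| / q := by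
        rw [Real.cosh_arsinh, Real.sqrt_eq_iff_mul_self_eq (by positivity) (by positivity),
          div_mul_div_comm, abs_mul_abs_self, ← sq, hbc]
        field_simp
        linear_combination r ^ 2 * hσ
      have hs : Real.arsinh (σ * r / q) ≠ 0 := by
        rw [Ne, Real.arsinh_eq_zero_iff]
        positivity
      refine ⟨Real.arsinh (σ * r / q), ?_⟩
      simp only [perpAt, dif_neg hs, hcosh, Real.sinh_arsinh]
      congr 1
      · field_simp
        linear_combination σ * hσd + |b - c| * hσ
      · rw [abs_div, abs_mul, hσ1, abs_of_pos hr, abs_of_pos hq]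
        field_simp

/-! ### Metric properties of the orthogonal projection -/

/-- With `x = sinh u` and `y = sinh v` this is `1 ≤ cosh (u - v)`. -/
theorem one_le_sqrt_mul_sqrt_sub_mul (x y : ℝ) :
    1 ≤ √(1 + x ^ 2) * √(1 + y ^ 2) - x * y := by
  rw [← Real.sqrt_mul (by positivity), le_sub_iff_add_le]
  refine Real.le_sqrt_of_sq_le ?_
  nlinarith [sq_nonneg (x - y)]

/-- Orthogonal projection onto a geodesic does not increase distances. -/
theorem abs_coord_sub_le_dist (M : Geodesic) (z w : ℍ) : |M.coord z - M.coord w| ≤ dist z w := by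
  rw [← abs_of_nonneg (dist_nonneg (x := z) (y := w)), ← Real.cosh_le_cosh, M.cosh_dist_eq]
  have h1 := Real.one_le_cosh (M.coord z - M.coord w)
  have h2 : 1 ≤ √(1 + M.height z ^ 2) * √(1 + M.height w ^ 2) :=
    one_le_mul_of_one_le_of_one_le (Real.one_le_sqrt.2 (by nlinarith [sq_nonneg (M.height z)]))
      (Real.one_le_sqrt.2 (by nlinarith [sq_nonneg (M.height w)]))
  nlinarith [one_le_sqrt_mul_sqrt_sub_mul (M.height z) (M.height w)]

/-- Orthogonal projection onto a geodesic strictly decreases the distance of two distinct points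
that do not both lie on the geodesic. -/
theorem mem_of_abs_coord_sub_eq_dist {M : Geodesic} {z w : ℍ} (hne : z ≠ w)
    (h : |M.coord z - M.coord w| = dist z w) : z ∈ M ∧ w ∈ M := by
  have hlt : 1 < Real.cosh (M.coord z - M.coord w) := by
    rw [Real.one_lt_cosh, ← abs_pos, h]
    exact dist_pos.2 hne
  have hc : Real.cosh (dist z w) = Real.cosh (M.coord z - M.coord w) := by rw [← h, Real.cosh_abs]
  rw [M.cosh_dist_eq] at hc
  have h1 := one_le_sqrt_mul_sqrt_sub_mul (M.height z) (M.height w)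
  have hz := Real.one_le_sqrt.2 (show 1 ≤ 1 + M.height z ^ 2 by nlinarith [sq_nonneg (M.height z)])
  have hw := Real.one_le_sqrt.2 (show 1 ≤ 1 + M.height w ^ 2 by nlinarith [sq_nonneg (M.height w)])
  have hzs := Real.sq_sqrt (show 0 ≤ 1 + M.height z ^ 2 by positivity)
  have hws := Real.sq_sqrt (show 0 ≤ 1 + M.height w ^ 2 by positivity)
  rw [mem_iff_height_eq_zero, mem_iff_height_eq_zero]
  set C := √(1 + M.height z ^ 2)
  set D := √(1 + M.height w ^ 2)
  have hCD : C * D ≤ 1 := by nlinarith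
  -- Both factors are at least `1`, so both are `1` and both heights vanish.
  have hC : C = 1 := by nlinarith
  have hD : D = 1 := by nlinarith
  rw [hC] at hzs
  rw [hD] at hws
  exact ⟨pow_eq_zero_iff two_ne_zero |>.1 (by linarith),
    pow_eq_zero_iff two_ne_zero |>.1 (by linarith)⟩

theorem dist_eq_abs_coord_sub {M : Geodesic} {z w : ℍ} (hz : z ∈ M) (hw : w ∈ M) :
    dist z w = |M.coord z - M.coord w| := by
  rw [mem_iff_height_eq_zero] at hz hw
  have h := M.cosh_dist_eq z w
  rw [hz, hw] at h
  norm_num at h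
  have h := le_antisymm (Real.cosh_le_cosh.1 h.le) (Real.cosh_le_cosh.1 h.ge)
  rwa [abs_of_nonneg dist_nonneg] at h

theorem isometry_param (M : Geodesic) : Isometry M.param :=
  Isometry.of_dist_eq fun s t => by
    rw [dist_eq_abs_coord_sub (M.param_mem s) (M.param_mem t), coord_param, coord_param,
      Real.dist_eq]

theorem param_coord {M : Geodesic} {z : ℍ} (hz : z ∈ M) : M.param (M.coord z) = z := by
  rw [← dist_eq_zero, dist_eq_abs_coord_sub (M.param_mem _) hz, coord_param, sub_self, abs_zero]

theorem continuous_coord (M : Geodesic) : Continuous M.coord :=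
  (LipschitzWith.of_dist_le_mul (K := 1) fun z w => by
    simpa [Real.dist_eq] using M.abs_coord_sub_le_dist z w).continuous

/-- The perpendiculars of `M` are the fibres of the projection onto `M`. -/
theorem perp_iff {M N : Geodesic} : M.Perp N ↔ ∃ s, N = M.perpAt s :=
  ⟨Perp.exists_eq_perpAt, by rintro ⟨s, rfl⟩; exact M.perp_perpAt s⟩

end Geodesic

/-! ### Projections, supporting perpendiculars and constant width -/

open Geodesic

theorem projection_eq_image (M : Geodesic) (K : Set ℍ) :
    projection M K = M.param '' (M.coord '' K) := by
  ext x
  simp only [projection, Set.mem_ofPred_eq, Set.mem_image, exists_exists_and_eq_and]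
  constructor
  · rintro ⟨hx, N, hN, hxN, z, hz, hzN⟩
    obtain ⟨s, rfl⟩ := perp_iff.1 (perp_comm.1 hN)
    rw [mem_perpAt] at hxN hzN
    exact ⟨z, hz, by rw [hzN, ← hxN, param_coord hx]⟩
  · rintro ⟨z, hz, rfl⟩
    exact ⟨M.param_mem _, M.perpAt (M.coord z), perp_comm.1 (M.perp_perpAt _),
      mem_perpAt.2 (M.coord_param _), z, hz, mem_perpAt.2 rfl⟩

/-- The perpendicular of `M` at coordinate `s` supports `K` precisely when `s` is attained on the
boundary and is extremal among the coordinates of the points of `K`. -/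
theorem supports_perpAt_iff {M : Geodesic} {K : Set ℍ} {s : ℝ} :
    Supports (M.perpAt s) K ↔ (∃ x ∈ frontier K, M.coord x = s) ∧
      ((∀ z ∈ K, s ≤ M.coord z) ∨ (∀ z ∈ K, M.coord z ≤ s)) := by
  simp only [Supports, mem_perpAt]
  refine and_congr_right fun _ => ?_
  rcases M.perpAt_side s with h | h
  · simp only [fun z => (h z).1, fun z => (h z).2]
  · simp only [fun z => (h z).1, fun z => (h z).2]
    exact or_comm

/-- A point of a geodesic `M` whose coordinate is extremal on `K` is a boundary point of `K`, since
the points of `M` just beyond it do not belong to `K`. -/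
theorem mem_frontier_of_extremal {M : Geodesic} {K : Set ℍ} {p : ℍ} (hp : p ∈ K) (hpM : p ∈ M)
    (h : (∀ z ∈ K, M.coord p ≤ M.coord z) ∨ (∀ z ∈ K, M.coord z ≤ M.coord p)) :
    p ∈ frontier K := by
  refine ⟨subset_closure hp, fun hi => ?_⟩
  have hnhds : M.param ⁻¹' K ∈ nhds (M.coord p) := by
    refine M.isometry_param.continuous.continuousAt.preimage_mem_nhds ?_
    rw [param_coord hpM]
    exact mem_interior_iff_mem_nhds.1 hi
  obtain ⟨ε, hε, hball⟩ := Metric.mem_nhds_iff.1 hnhds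
  have key : ∀ d : ℝ, |d| < ε → M.param (M.coord p + d) ∈ K := fun d hd =>
    hball (by simpa [Real.dist_eq] using hd)
  have hε2 : |ε / 2| < ε := by rw [abs_of_pos (half_pos hε)]; exact half_lt_self hε
  rcases h with h | h
  · have := h _ (key (-(ε / 2)) (by rwa [abs_neg]))
    rw [coord_param] at this
    linarith
  · have := h _ (key (ε / 2) hε2)
    rw [coord_param] at this
    linarith

theorem isNormalAt_of_extremal {M : Geodesic} {K : Set ℍ} {p : ℍ} (hp : p ∈ K) (hpM : p ∈ M)
    (h : (∀ z ∈ K, M.coord p ≤ M.coord z) ∨ (∀ z ∈ K, M.coord z ≤ M.coord p)) :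
    IsNormalAt M K p :=
  have hf := mem_frontier_of_extremal hp hpM h
  ⟨hf, hpM, M.perpAt (M.coord p), supports_perpAt_iff.2 ⟨⟨p, hf, rfl⟩, h⟩, mem_perpAt.2 rfl,
    M.perp_perpAt _⟩

namespace IsConvexBody

theorem frontier_subset {K : Set ℍ} (hK : IsConvexBody K) : frontier K ⊆ K :=
  hK.isCompact.isClosed.frontier_subset

theorem isPreconnected {K : Set ℍ} (hK : IsConvexBody K) : IsPreconnected K := by
  refine isPreconnected_of_forall_pair fun x hx y hy => ?_
  obtain ⟨M, hxM, hyM⟩ := exists_mem_mem x y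
  refine ⟨M.param '' Set.uIcc (M.coord x) (M.coord y), ?_, ⟨_, Set.left_mem_uIcc, param_coord hxM⟩,
    ⟨_, Set.right_mem_uIcc, param_coord hyM⟩,
    isPreconnected_uIcc.image _ M.isometry_param.continuous.continuousOn⟩
  rintro _ ⟨s, hs, rfl⟩
  refine hK.segment_subset x hx y hy ?_
  rw [segment, Set.mem_ofPred_eq, dist_eq_abs_coord_sub hxM (M.param_mem s),
    dist_eq_abs_coord_sub (M.param_mem s) hyM, dist_eq_abs_coord_sub hxM hyM, coord_param]
  rcases Set.mem_uIcc.1 hs with ⟨h1, h2⟩ | ⟨h1, h2⟩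
  · rw [abs_of_nonpos (by linarith), abs_of_nonpos (by linarith), abs_of_nonpos (by linarith)]
    ring
  · rw [abs_of_nonneg (by linarith), abs_of_nonneg (by linarith), abs_of_nonneg (by linarith)]
    ring

/-- The projection of a convex body is a closed interval whose end points are the projections of
points of the body. -/
theorem exists_coord_image_eq {K : Set ℍ} (hK : IsConvexBody K) (M : Geodesic) : ∃ p ∈ K, ∃ q ∈ K,
    M.coord '' K = Set.Icc (M.coord p) (M.coord q) := by
  have hne : K.Nonempty := hK.interior_nonempty.mono interior_subset
  obtain ⟨p, hp, hpm⟩ := hK.isCompact.exists_isMinOn hne M.continuous_coord.continuousOn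
  obtain ⟨q, hq, hqm⟩ := hK.isCompact.exists_isMaxOn hne M.continuous_coord.continuousOn
  refine ⟨p, hp, q, hq, Set.Subset.antisymm ?_ ?_⟩
  · rintro _ ⟨z, hz, rfl⟩
    exact ⟨hpm hz, hqm hz⟩
  · exact (hK.isPreconnected.image _ M.continuous_coord.continuousOn).Icc_subset
      (Set.mem_image_of_mem _ hp) (Set.mem_image_of_mem _ hq)

/-- A non-empty interior forces two points, as the upper half-plane has no isolated point. -/
theorem nontrivial {K : Set ℍ} (hK : IsConvexBody K) : K.Nontrivial := by
  obtain ⟨p, hp⟩ := hK.interior_nonempty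
  by_contra h
  have hs := Set.not_nontrivial_iff.1 h
  have hpM : p ∈ vertical p.re := by simp [mem_iff, side]
  refine (mem_frontier_of_extremal (interior_subset hp) hpM (Or.inl fun z hz => ?_)).2 hp
  rw [hs hz (interior_subset hp)]

end IsConvexBody

/-- If `M` is a normal geodesic of `K`, then the width of `K` along `M` is the length of the
projection of `K` onto `M`: the two supporting geodesics perpendicular to `M` are the perpendiculars
at the end points of the projection. -/
theorem HasConstantWidth.sub_eq_of_isNormalAt {K : Set ℍ} {w : ℝ} (hw : HasConstantWidth K w)
    (hK : IsConvexBody K) {M : Geodesic} {x : ℍ} (hx : IsNormalAt M K x) {a b : ℝ}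
    (hab : M.coord '' K = Set.Icc a b) : b - a = w := by
  have hne : K.Nonempty := hK.interior_nonempty.mono interior_subset
  have hle : a ≤ b := Set.nonempty_Icc.1 (hab ▸ hne.image _)
  obtain ⟨Γ, Γ₂, y, hΓ, hxΓ, hMΓ, hΓne, hΓ₂, hMΓ₂, hyM, hyΓ₂, hd⟩ := hw x M hx
  obtain ⟨s, rfl⟩ := perp_iff.1 hMΓ
  obtain ⟨t, rfl⟩ := perp_iff.1 hMΓ₂
  have hst : t ≠ s := fun h => hΓne (h ▸ rfl)
  have hext : ∀ u, Supports (M.perpAt u) K → u = a ∨ u = b := fun u hu => by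
    obtain ⟨⟨z, hz, rfl⟩, h⟩ := supports_perpAt_iff.1 hu
    have hzI : M.coord z ∈ Set.Icc a b :=
      hab ▸ Set.mem_image_of_mem _ (hK.frontier_subset hz)
    refine h.imp (fun h => ?_) (fun h => ?_)
    · obtain ⟨v, hv, hva⟩ : a ∈ M.coord '' K := hab ▸ Set.left_mem_Icc.2 hle
      exact le_antisymm (hva ▸ h v hv) hzI.1
    · obtain ⟨v, hv, hvb⟩ : b ∈ M.coord '' K := hab ▸ Set.right_mem_Icc.2 hle
      exact le_antisymm hzI.2 (hvb ▸ h v hv)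
  rw [dist_eq_abs_coord_sub hx.2.1 hyM, mem_perpAt.1 hxΓ, mem_perpAt.1 hyΓ₂] at hd
  rcases hext s hΓ with rfl | rfl <;> rcases hext t hΓ₂ with rfl | rfl
  · exact absurd rfl hst
  · rwa [abs_sub_comm, abs_of_nonneg (sub_nonneg.2 hle)] at hd
  · rwa [abs_of_nonneg (sub_nonneg.2 hle)] at hd
  · exact absurd rfl hst

/-- A body of constant width `w` has diameter at most `w`: the geodesic through two points at
maximal distance is normal at both of them, as the projection onto it does not increase
distances. -/
theorem HasConstantWidth.dist_le {K : Set ℍ} {w : ℝ} (hw : HasConstantWidth K w)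
    (hK : IsConvexBody K) {x y : ℍ} (hx : x ∈ K) (hy : y ∈ K) : dist x y ≤ w := by
  obtain ⟨⟨p, q⟩, ⟨hp, hq⟩, hmax⟩ := (hK.isCompact.prod hK.isCompact).exists_isMaxOn
    ⟨(x, y), hx, hy⟩ (continuous_dist (α := ℍ)).continuousOn
  replace hmax : ∀ u ∈ K, ∀ v ∈ K, dist u v ≤ dist p q := fun u hu v hv =>
    hmax (Set.mk_mem_prod hu hv)
  change p ∈ K at hp
  change q ∈ K at hq
  obtain ⟨N, hpN, hqN⟩ := exists_mem_mem p q
  wlog hle : N.coord p ≤ N.coord q generalizing p q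
  · exact this q p (by simpa only [dist_comm q p] using hmax) hq hp hqN hpN (le_of_not_ge hle)
  have hD : dist p q = N.coord q - N.coord p := by
    rw [dist_eq_abs_coord_sub hpN hqN, abs_sub_comm, abs_of_nonneg (sub_nonneg.2 hle)]
  have hlow : ∀ z ∈ K, N.coord p ≤ N.coord z := fun z hz => by
    have h1 := N.abs_coord_sub_le_dist q z
    have h2 := hmax q hq z hz
    have h3 := le_abs_self (N.coord q - N.coord z)
    linarith
  have hupp : ∀ z ∈ K, N.coord z ≤ N.coord q := fun z hz => by
    have h1 := N.abs_coord_sub_le_dist z p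
    have h2 := hmax z hz p hp
    have h3 := le_abs_self (N.coord z - N.coord p)
    linarith
  have himg : N.coord '' K = Set.Icc (N.coord p) (N.coord q) := by
    obtain ⟨u, hu, v, hv, h⟩ := hK.exists_coord_image_eq N
    have h1 : N.coord p ∈ Set.Icc (N.coord u) (N.coord v) := h ▸ Set.mem_image_of_mem _ hp
    have h2 : N.coord q ∈ Set.Icc (N.coord u) (N.coord v) := h ▸ Set.mem_image_of_mem _ hq
    rw [h, le_antisymm (hlow u hu) h1.1, le_antisymm h2.2 (hupp v hv)]
  rw [← hw.sub_eq_of_isNormalAt hK (isNormalAt_of_extremal hp hpN (Or.inl hlow)) himg, ← hD]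
  exact hmax x hx y hy

/-- The length of the projection is read off the coordinate, `M.param` being an isometry. -/
theorem length_projection {M : Geodesic} {K : Set ℍ} {a b : ℝ}
    (hab : M.coord '' K = Set.Icc a b) : length (projection M K) = ENNReal.ofReal (b - a) := by
  rw [length, projection_eq_image, hab,
    M.isometry_param.hausdorffMeasure_image (Or.inl zero_le_one),
    MeasureTheory.hausdorffMeasure_real, Real.volume_Icc]

end HypPlane

theorem mainTheorem3 (K : Set UpperHalfPlane) (w : ℝ) (hK : HypPlane.IsConvexBody K)
    (hw : HypPlane.HasConstantWidth K w) (M : HypPlane.Geodesic) :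
    HypPlane.length (HypPlane.projection M K) ≤ ENNReal.ofReal w ∧
      (HypPlane.length (HypPlane.projection M K) = ENNReal.ofReal w ↔
        HypPlane.IsDoubleNormal M K) := by
  obtain ⟨p, hp, q, hq, hab⟩ := hK.exists_coord_image_eq M
  have hle : M.coord q - M.coord p ≤ dist q p :=
    (le_abs_self _).trans (M.abs_coord_sub_le_dist q p)
  have hdist := hw.dist_le hK hq hp
  have hw0 : 0 < w := by
    obtain ⟨x, hx, y, hy, hxy⟩ := hK.nontrivial
    exact (dist_pos.2 hxy).trans_le (hw.dist_le hK hx hy)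
  rw [HypPlane.length_projection hab]
  refine ⟨ENNReal.ofReal_le_ofReal (hle.trans hdist), fun h => ?_, ?_⟩
  · have hpq : M.coord q - M.coord p = w := by
      have hpq0 : M.coord p ≤ M.coord q := Set.nonempty_Icc.1 (hab ▸ Set.Nonempty.image _ ⟨p, hp⟩)
      exact (ENNReal.ofReal_eq_ofReal_iff (sub_nonneg.2 hpq0) hw0.le).1 h
    have hqp : q ≠ p := by
      rintro rfl
      linarith
    -- Equality forces `p` and `q` onto `M`, the projection being strictly contracting off `M`.
    obtain ⟨hqM, hpM⟩ := HypPlane.Geodesic.mem_of_abs_coord_sub_eq_dist (M := M) hqp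
      (le_antisymm (M.abs_coord_sub_le_dist q p)
        (hdist.trans (hpq.ge.trans (le_abs_self _))))
    have hmem : ∀ z ∈ K, M.coord z ∈ Set.Icc (M.coord p) (M.coord q) := fun z hz =>
      hab ▸ Set.mem_image_of_mem _ hz
    exact ⟨q, p, hqp, HypPlane.isNormalAt_of_extremal hq hqM (Or.inr fun z hz => (hmem z hz).2),
      HypPlane.isNormalAt_of_extremal hp hpM (Or.inl fun z hz => (hmem z hz).1)⟩
  · rintro ⟨x, _, _, hx, _⟩
    rw [hw.sub_eq_of_isNormalAt hK hx hab]
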